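/- Let $\Sigma\in\mathbb R^{d\times d}$ be positive definite, $\sigma>0$ and $\theta\in\mathbb R^d$. There are $m\ge 1$ agents. Agent $i$ has a view given by a permutation matrix $\Pi_i$, $\Pi_i^\top=[\Pi_{i+}^\top\ \Pi_{i-}^\top]$, where $\Pi_{i+}\in\mathbb R^{d_i\times d}$ selects the coordinates it observes and $\Pi_{i-}\in\mathbb R^{(d-d_i)\times d}$ those it does not observe. Write $v_{i\pm}$ for $\Pi_{i\pm}v$ (subvectors), $\Sigma_{i+}=\Pi_{i+}\Sigma\Pi_{i+}^\top$, $\Sigma_{i-}=\Pi_{i-}\Sigma\Pi_{i-}^\top$, $\Sigma_{i\pm}=\Pi_{i+}\Sigma\Pi_{i-}^\top$ and $\Sigma_{i\mp}=\Pi_{i-}\Sigma\Pi_{i+}^\top$ (blocks), and put $$T_i=\begin{bmatrix} I_{d_i} & \Sigma_{i+}^{-1}\Sigma_{i\pm}\end{bmatrix}\Pi_i,\qquad \Gamma_{i-}=\Sigma_{i-}-\Sigma_{i\mp}\Sigma_{i+}^{-1}\Sigma_{i\pm},\qquad \|\theta_{i-}\|_{\Gamma_{i-}}^2=\theta_{i-}^\top\Gamma_{i-}\theta_{i-},$$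 $$C^{s}=\Big(\sum_{i=1}^m\frac{2\Sigma}{\|\theta_{i-}\|_{\Gamma_{i-}}^2+\sigma^2}\Big)^{-1}.$$ *Observation model.* Given $n$ and observed feature matrices $X_{i+}\in\mathbb R^{n\times d_i}$, $i\in[m]$, with rows $x_{i+}^{(k)}$, and a parameter $\theta'\in\mathbb R^d$, let $P^y_{\theta'}$ be the law of all labels $y=(y_i^{(k)})_{i\le m,\,k\le n}$, $$y_i^{(k)}=\langle x_{i+}^{(k)},\theta'_{i+}\rangle+\langle x_{i-}^{(k)},\theta'_{i-}\rangle+\xi_i^{(k)},\qquad x_{i-}^{(k)}\sim\mathsf N(\Sigma_{i\mp}\Sigma_{i+}^{-1}x_{i+}^{(k)},\Gamma_{i-}),\quad \xi_i^{(k)}\sim\mathsf N(0,\sigma^2),$$ where all $x_{i-}^{(k)}$ and $\xi_i^{(k)}$ are independent. For a target $\psi:\mathbb R^d\to\mathbb R^s$, $u\in\mathbb R^s$ and $c>0$, define the local minimax risk around $\theta$ $$R_{n,c}(\psi,u)=\inf_{\bar\theta}\ \sup_{\|\theta'-\theta\|_2\le c\,n^{-1/2}} n\,\mathbb E_{y\sim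 P^y_{\theta'}}\big\langle u,\ \bar\theta(y,X_{1+},\dots,X_{m+})-\psi(\theta')\big\rangle^2\in[0,\infty],$$ the infimum being over all measurable functions $\bar\theta$ of the labels and the observed features with values in $\mathbb R^s$. **Theorem.** On some probability space let there be, for every $n$ and every $i\in[m]$, a random matrix $X_{i+}=X_{i+}^{(n)}\in\mathbb R^{n\times d_i}$ whose $n$ rows are i.i.d. $\mathsf N(0,\Sigma_{i+})$ (the joint dependence between different $i$ and different $n$ may be arbitrary). Then: 1. for every $u\in\mathbb R^d$, with probability $1$ over the features, $$\liminf_{c\to\infty}\liminf_{n\to\infty}R_{n,c}(\mathrm{id},u)\ \ge\ u^\top C^{s}u;$$ 2. for every $i\in[m]$ and every $u\in\mathbb R^{d_i}$, with probability $1$ over the features, $$\liminf_{c\to\infty}\liminf_{n\to\infty}R_{n,c}(\theta'\mapsto T_i\theta',u)\ \ge\ u^\top T_iC^{s}T_i^\top u.$$ -/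

import Mathlib

open MeasureTheory ProbabilityTheory Filter
open scoped ENNReal Matrix

noncomputable section

/-- A view of an agent on `ℝ^d`: it observes `numObs` of the `d` coordinates and misses the other
`numMis`. The bijection `perm` is the permutation `Π = [Π₊; Π₋]`: `perm (inl a)` is the `a`-th
observed coordinate and `perm (inr b)` is the `b`-th missing one. -/
structure AgentView (d : ℕ) where
  numObs : ℕ
  numMis : ℕ
  perm : Fin numObs ⊕ Fin numMis ≃ Fin d

namespace AgentView

variable {d : ℕ} (V : AgentView d)

/-- The subvector `v₊ = Π₊ v` of observed coordinates. -/
def obs (v : EuclideanSpace ℝ (Fin d)) : EuclideanSpace ℝ (Fin V.numObs) :=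
  WithLp.toLp 2 fun a => v (V.perm (Sum.inl a))

/-- The subvector `v₋ = Π₋ v` of missing coordinates. -/
def mis (v : EuclideanSpace ℝ (Fin d)) : EuclideanSpace ℝ (Fin V.numMis) :=
  WithLp.toLp 2 fun b => v (V.perm (Sum.inr b))

/-- `A₊ = Π₊ A Π₊ᵀ`. -/
def blockPlus (A : Matrix (Fin d) (Fin d) ℝ) : Matrix (Fin V.numObs) (Fin V.numObs) ℝ :=
  A.submatrix (fun a => V.perm (Sum.inl a)) (fun a => V.perm (Sum.inl a))

/-- `A₋ = Π₋ A Π₋ᵀ`. -/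
def blockMinus (A : Matrix (Fin d) (Fin d) ℝ) : Matrix (Fin V.numMis) (Fin V.numMis) ℝ :=
  A.submatrix (fun b => V.perm (Sum.inr b)) (fun b => V.perm (Sum.inr b))

/-- `A_± = Π₊ A Π₋ᵀ`. -/
def blockPM (A : Matrix (Fin d) (Fin d) ℝ) : Matrix (Fin V.numObs) (Fin V.numMis) ℝ :=
  A.submatrix (fun a => V.perm (Sum.inl a)) (fun b => V.perm (Sum.inr b))

/-- `A_∓ = Π₋ A Π₊ᵀ`. -/
def blockMP (A : Matrix (Fin d) (Fin d) ℝ) : Matrix (Fin V.numMis) (Fin V.numObs) ℝ :=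
  A.submatrix (fun b => V.perm (Sum.inr b)) (fun a => V.perm (Sum.inl a))

/-- `T = [I, Σ₊⁻¹ Σ_±] Π`. -/
def T (S : Matrix (Fin d) (Fin d) ℝ) : Matrix (Fin V.numObs) (Fin d) ℝ :=
  (Matrix.fromCols 1 ((V.blockPlus S)⁻¹ * V.blockPM S)).submatrix id V.perm.symm

/-- The Schur complement `Γ₋ = Σ₋ - Σ_∓ Σ₊⁻¹ Σ_±`, the conditional covariance of the missing
features given the observed ones. -/
def schur (S : Matrix (Fin d) (Fin d) ℝ) : Matrix (Fin V.numMis) (Fin V.numMis) ℝ :=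
  V.blockMinus S - V.blockMP S * (V.blockPlus S)⁻¹ * V.blockPM S

/-- The conditional mean `μ₋ = Σ_∓ Σ₊⁻¹ x₊` of the missing features given the observed ones. -/
def condMean (S : Matrix (Fin d) (Fin d) ℝ) (x : EuclideanSpace ℝ (Fin V.numObs)) :
    EuclideanSpace ℝ (Fin V.numMis) :=
  WithLp.toLp 2 ((V.blockMP S * (V.blockPlus S)⁻¹) *ᵥ x.ofLp)

/-- The quadratic form `‖θ₋‖²_{Γ₋} = ⟨θ₋, Γ₋ θ₋⟩`. -/
def misVar (S : Matrix (Fin d) (Fin d) ℝ) (θ : EuclideanSpace ℝ (Fin d)) : ℝ :=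
  (V.mis θ).ofLp ⬝ᵥ (V.schur S *ᵥ (V.mis θ).ofLp)

/-- The law of one label `y = ⟨x₊, θ₊⟩ + ⟨x₋, θ₋⟩ + ξ` for a fixed observed feature vector `x₊`,
where `x₋ ∼ N(μ₋, Γ₋)` and `ξ ∼ N(0, σ²)` are independent. -/
def labelLaw (S : Matrix (Fin d) (Fin d) ℝ) (σ : ℝ) (θ : EuclideanSpace ℝ (Fin d))
    (x : EuclideanSpace ℝ (Fin V.numObs)) : Measure ℝ :=
  ((multivariateGaussian (V.condMean S x) (V.schur S)).prod
      (gaussianReal 0 (σ ^ 2).toNNReal)).map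
    fun p => inner ℝ x (V.obs θ) + inner ℝ p.1 (V.mis θ) + p.2

end AgentView

/-- All observed features: agent `i` has the `n` rows `x i k` of its matrix `X_{i+}`. -/
abbrev ObsFeatures {d m : ℕ} (V : Fin m → AgentView d) (n : ℕ) : Type :=
  (i : Fin m) → Fin n → EuclideanSpace ℝ (Fin (V i).numObs)

/-- All labels: agent `i` has the `n` labels `y i k`. -/
abbrev Labels (m n : ℕ) : Type := Fin m → Fin n → ℝ

/-- The law `P_θ^y` of all labels of all agents given the observed features; labels are
independent across samples and agents. -/
def labelsLaw {d m : ℕ} (V : Fin m → AgentView d) (S : Matrix (Fin d) (Fin d) ℝ) (σ : ℝ) {n : ℕ}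
    (x : ObsFeatures V n) (θ : EuclideanSpace ℝ (Fin d)) : Measure (Labels m n) :=
  Measure.pi fun i => Measure.pi fun k => (V i).labelLaw S σ θ (x i k)

/-- The local minimax risk
`inf_est sup_{‖θ' - θ‖ ≤ c n^{-1/2}} n E_{y ∼ P_θ'} ⟨u, est(y, x) - ψ(θ')⟩²` for the target `ψ`,
the infimum being over all measurable functions of the labels and the observed features. -/
def localMinimaxRisk {d m s : ℕ} (V : Fin m → AgentView d) (S : Matrix (Fin d) (Fin d) ℝ) (σ : ℝ)
    (ψ : EuclideanSpace ℝ (Fin d) → EuclideanSpace ℝ (Fin s)) (θ : EuclideanSpace ℝ (Fin d))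
    (c : ℝ) (n : ℕ) (x : ObsFeatures V n) (u : EuclideanSpace ℝ (Fin s)) : ℝ≥0∞ :=
  ⨅ (est : Labels m n × ObsFeatures V n → EuclideanSpace ℝ (Fin s)) (_ : Measurable est),
    ⨆ θ' ∈ Metric.closedBall θ (c / √(n : ℝ)),
      (n : ℝ≥0∞) * ∫⁻ y, ENNReal.ofReal (inner ℝ u (est (y, x) - ψ θ') ^ 2)
        ∂(labelsLaw V S σ x θ')

/-- The strong lower bound matrix `C^s = (∑ᵢ 2 Σ / (‖θ_{i-}‖²_{Γ_{i-}} + σ²))⁻¹`. -/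
def strongBound {d m : ℕ} (V : Fin m → AgentView d) (S : Matrix (Fin d) (Fin d) ℝ) (σ : ℝ)
    (θ : EuclideanSpace ℝ (Fin d)) : Matrix (Fin d) (Fin d) ℝ :=
  (∑ i, (2 / ((V i).misVar S θ + σ ^ 2)) • S)⁻¹

end

noncomputable section

/-- The law with density `p t` with respect to `ν`. -/
def modelLaw {Y : Type*} [MeasurableSpace Y] (ν : Measure Y) (p : ℝ → Y → ℝ) (t : ℝ) : Measure Y :=
  ν.withDensity fun y => ENNReal.ofReal (p t y)

/-- A one-parameter family of laws with densities `p t` with respect to `ν`, scores `s t` and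
Fisher information `J t`. -/
structure IsRegularModel {Y : Type*} [MeasurableSpace Y] (ν : Measure Y) (p s : ℝ → Y → ℝ)
    (J : ℝ → ℝ) : Prop where
  nonneg : ∀ t y, 0 ≤ p t y
  measurable_density : Measurable (Function.uncurry p)
  measurable_score : Measurable (Function.uncurry s)
  hasDerivAt : ∀ t y, HasDerivAt (fun t => p t y) (s t y * p t y) t
  continuous_score : ∀ y, Continuous fun t => s t y
  isProbabilityMeasure : ∀ t, IsProbabilityMeasure (modelLaw ν p t)
  memLp_score : ∀ t, MemLp (s t) 2 (modelLaw ν p t)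
  integral_score : ∀ t, ∫ y, s t y ∂(modelLaw ν p t) = 0
  integral_score_sq : ∀ t, ∫ y, s t y ^ 2 ∂(modelLaw ν p t) = J t

namespace IsRegularModel

variable {Y : Type*} [MeasurableSpace Y] {ν : Measure Y} {p s : ℝ → Y → ℝ} {J : ℝ → ℝ}

lemma continuous_density (h : IsRegularModel ν p s J) (y : Y) : Continuous fun t => p t y :=
  continuous_iff_continuousAt.2 fun t => (h.hasDerivAt t y).continuousAt

lemma measurable_density_apply (h : IsRegularModel ν p s J) (t : ℝ) : Measurable (p t) :=
  h.measurable_density.comp measurable_prodMk_left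

lemma measurable_score_apply (h : IsRegularModel ν p s J) (t : ℝ) : Measurable (s t) :=
  h.measurable_score.comp measurable_prodMk_left

lemma lintegral_modelLaw (h : IsRegularModel ν p s J) (t : ℝ) {f : Y → ℝ} (hf : Measurable f) :
    ∫⁻ y, ENNReal.ofReal (f y) ∂(modelLaw ν p t) = ∫⁻ y, ENNReal.ofReal (f y * p t y) ∂ν := by
  rw [modelLaw, lintegral_withDensity_eq_lintegral_mul _
    (h.measurable_density_apply t).ennreal_ofReal hf.ennreal_ofReal]
  refine lintegral_congr fun y => ?_
  rw [Pi.mul_apply, mul_comm, ENNReal.ofReal_mul' (h.nonneg t y)]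

lemma integrable_density (h : IsRegularModel ν p s J) (t : ℝ) : Integrable (p t) ν := by
  refine ⟨(h.measurable_density_apply t).aestronglyMeasurable, ?_⟩
  rw [hasFiniteIntegral_iff_ofReal (.of_forall (h.nonneg t))]
  have := h.lintegral_modelLaw t (f := fun _ => 1) measurable_const
  have hp := h.isProbabilityMeasure t
  simp only [one_mul] at this
  rw [← this]
  simp

lemma integral_density (h : IsRegularModel ν p s J) (t : ℝ) : ∫ y, p t y ∂ν = 1 := by
  have := h.lintegral_modelLaw t (f := fun _ => 1) measurable_const
  have hp := h.isProbabilityMeasure t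
  rw [integral_eq_lintegral_of_nonneg_ae (.of_forall (h.nonneg t))
    (h.measurable_density_apply t).aestronglyMeasurable]
  simp only [one_mul] at this
  rw [← this]
  simp

lemma info_nonneg (h : IsRegularModel ν p s J) (t : ℝ) : 0 ≤ J t := by
  rw [← h.integral_score_sq t]
  exact integral_nonneg fun y => sq_nonneg _

lemma lintegral_affine_score_sq (h : IsRegularModel ν p s J) (t a b : ℝ) :
    ∫⁻ y, ENNReal.ofReal ((a * s t y + b) ^ 2) ∂(modelLaw ν p t)
      = ENNReal.ofReal (a ^ 2 * J t + b ^ 2) := by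
  have hp := h.isProbabilityMeasure t
  have h1 : Integrable (s t) (modelLaw ν p t) := (h.memLp_score t).integrable (by norm_num)
  have h2 : Integrable (fun y => s t y ^ 2) (modelLaw ν p t) := (h.memLp_score t).integrable_sq
  have e : (fun y => (a * s t y + b) ^ 2)
      = fun y => a ^ 2 * s t y ^ 2 + 2 * a * b * s t y + b ^ 2 := by
    funext y; ring
  have hi : Integrable (fun y => (a * s t y + b) ^ 2) (modelLaw ν p t) := by
    rw [e]
    exact ((h2.const_mul _).add (h1.const_mul _)).add (integrable_const _)
  have h12 : Integrable (fun y => a ^ 2 * s t y ^ 2 + 2 * a * b * s t y) (modelLaw ν p t) :=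
    (h2.const_mul _).add (h1.const_mul _)
  rw [← ofReal_integral_eq_lintegral_ofReal hi (.of_forall fun y => sq_nonneg _), e,
    integral_add h12 (integrable_const _), integral_add (h2.const_mul _) (h1.const_mul _), integral_const_mul, integral_const_mul,
    h.integral_score, h.integral_score_sq]
  simp

lemma intervalIntegral_weighted_score (h : IsRegularModel ν p s J) (T g : ℝ) (y : Y) :
    ∫ t in (-T)..T, (T ^ 2 - t ^ 2) * (g - t) * ((T ^ 2 - t ^ 2) * s t y + -(4 * t)) * p t y
      = ∫ t in (-T)..T, (T ^ 2 - t ^ 2) ^ 2 * p t y := by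
  have hc := h.continuous_density y
  have hs := h.continuous_score y
  have hd : ∀ t, HasDerivAt (fun t => (T ^ 2 - t ^ 2) ^ 2 * p t y)
      ((T ^ 2 - t ^ 2) * ((T ^ 2 - t ^ 2) * s t y + -(4 * t)) * p t y) t := by
    intro t
    have h1 : HasDerivAt (fun t : ℝ => (T ^ 2 - t ^ 2) ^ 2)
        (2 * (T ^ 2 - t ^ 2) * (-(2 * t))) t := by
      have := (((hasDerivAt_id t).pow 2).const_sub (T ^ 2)).pow 2
      convert! this using 1
      simp
    convert! h1.mul (h.hasDerivAt t y) using 1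
    ring
  have hg : ∀ t, HasDerivAt (fun t : ℝ => g - t) (-1) t := fun t => (hasDerivAt_id t).const_sub g
  have key := intervalIntegral.integral_mul_deriv_eq_deriv_mul (a := -T) (b := T)
    (fun t _ => hg t) (fun t _ => hd t) (Continuous.intervalIntegrable (by fun_prop) _ _)
    (Continuous.intervalIntegrable (by fun_prop) _ _)
  have e : ∀ t, (T ^ 2 - t ^ 2) * (g - t) * ((T ^ 2 - t ^ 2) * s t y + -(4 * t)) * p t y
      = (g - t) * ((T ^ 2 - t ^ 2) * ((T ^ 2 - t ^ 2) * s t y + -(4 * t)) * p t y) :=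
    fun t => by ring
  simp_rw [e, key]
  simp

end IsRegularModel

lemma integral_sq_weight (T : ℝ) :
    ∫ t in (-T)..T, (T ^ 2 - t ^ 2) ^ 2 = 16 / 15 * T ^ 5 := by
  have e : ∀ t : ℝ, (T ^ 2 - t ^ 2) ^ 2 = T ^ 4 - 2 * T ^ 2 * t ^ 2 + t ^ 4 := fun t => by ring
  simp_rw [e]
  rw [intervalIntegral.integral_add, intervalIntegral.integral_sub,
    intervalIntegral.integral_const_mul, integral_pow, integral_pow,
    intervalIntegral.integral_const]
  · simp only [smul_eq_mul]; push_cast; ring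
  all_goals exact Continuous.intervalIntegrable (by fun_prop) _ _

/-- **Van Trees inequality** on the interval `[-T, T]`. -/
theorem IsRegularModel.vanTrees {Y : Type*} [MeasurableSpace Y] {ν : Measure Y} [SFinite ν]
    {p s : ℝ → Y → ℝ} {J : ℝ → ℝ} (h : IsRegularModel ν p s J) {T K : ℝ} (hT : 0 < T)
    (hK : ∀ t ∈ Set.Icc (-T) T, J t ≤ K) {g : Y → ℝ} (hg : Measurable g) {R : ℝ≥0∞}
    (hR : ∀ t ∈ Set.Icc (-T) T,
      ∫⁻ y, ENNReal.ofReal ((g y - t) ^ 2) ∂(modelLaw ν p t) ≤ R) :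
    ENNReal.ofReal (1 / (K + 10 / T ^ 2)) ≤ R := by
  rcases eq_or_ne R ⊤ with rfl | hRtop
  · exact le_top
  lift R to NNReal using hRtop
  obtain ⟨r, hr⟩ : ∃ r : ℝ, r = R := ⟨_, rfl⟩
  have hr0 : 0 ≤ r := hr ▸ R.2
  have hRr : (R : ℝ≥0∞) = ENNReal.ofReal r := by rw [hr, ENNReal.ofReal_coe_nnreal]
  have hK0 : 0 ≤ K := (h.info_nonneg 0).trans (hK 0 ⟨by linarith, hT.le⟩)
  set I : Set ℝ := Set.Ioc (-T) T with hI
  have hsub : ∀ t ∈ I, t ∈ Set.Icc (-T) T := fun t ht => Set.Ioc_subset_Icc_self ht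
  have hle : -T ≤ T := by linarith
  set M : Measure (ℝ × Y) := (volume.restrict I).prod ν with hM
  have mp := h.measurable_density
  have ms := h.measurable_score
  have mp' : Measurable fun z : ℝ × Y => p z.1 z.2 := mp
  have ms' : Measurable fun z : ℝ × Y => s z.1 z.2 := ms
  have mg' : Measurable fun z : ℝ × Y => g z.2 := hg.comp measurable_snd
  set A : ℝ × Y → ℝ := fun z => (T ^ 2 - z.1 ^ 2) * (g z.2 - z.1) with hA
  set B : ℝ × Y → ℝ := fun z => (T ^ 2 - z.1 ^ 2) * s z.1 z.2 + -(4 * z.1) with hB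
  have mA : Measurable A := by fun_prop
  have mB : Measurable B := by fun_prop
  have hp0 : ∀ z : ℝ × Y, 0 ≤ p z.1 z.2 := fun z => h.nonneg _ _
  have hII : ∀ {f : ℝ → ℝ}, Continuous f → Integrable f (volume.restrict I) := fun hf =>
    (hf.integrableOn_Icc (a := -T) (b := T)).mono_set Set.Ioc_subset_Icc_self
  have hW : ∫ t in I, (T ^ 2 - t ^ 2) ^ 2 = 16 / 15 * T ^ 5 := by
    rw [hI, ← intervalIntegral.integral_of_le hle, integral_sq_weight]
  have hQ : ∫ t in I, ((T ^ 2 - t ^ 2) ^ 2 * K + (4 * t) ^ 2)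
      = 16 / 15 * T ^ 5 * (K + 10 / T ^ 2) := by
    rw [integral_add (hII (by fun_prop)) (hII (by fun_prop)), integral_mul_const, hW, hI,
      ← intervalIntegral.integral_of_le hle]
    simp_rw [mul_pow]
    rw [intervalIntegral.integral_const_mul, integral_pow]
    field_simp
    push_cast
    ring
  -- bounds for the two squares
  have lA : ∫⁻ z, ENNReal.ofReal (A z ^ 2 * p z.1 z.2) ∂M
      ≤ ENNReal.ofReal (r * (16 / 15 * T ^ 5)) := by
    rw [hM, lintegral_prod _ (by fun_prop)]
    calc _ ≤ ∫⁻ t in I, ENNReal.ofReal r * ENNReal.ofReal ((T ^ 2 - t ^ 2) ^ 2) := by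
            refine setLIntegral_mono' measurableSet_Ioc fun t ht => ?_
            have e : ∀ y, ENNReal.ofReal (A (t, y) ^ 2 * p t y)
                = ENNReal.ofReal ((T ^ 2 - t ^ 2) ^ 2)
                  * ENNReal.ofReal ((g y - t) ^ 2 * p t y) := fun y => by
              rw [← ENNReal.ofReal_mul (sq_nonneg _), hA, mul_pow, mul_assoc]
            simp_rw [e]
            rw [lintegral_const_mul _ (by have := h.measurable_density_apply t; fun_prop),
              ← h.lintegral_modelLaw t (by fun_prop), mul_comm, ← hRr]
            gcongr
            exact hR t (hsub t ht)
      _ = _ := by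
            rw [lintegral_const_mul _ (by fun_prop), ENNReal.ofReal_mul hr0, ← hW,
              ofReal_integral_eq_lintegral_ofReal (hII (by fun_prop))
                (.of_forall fun t => sq_nonneg _)]
  have lB : ∫⁻ z, ENNReal.ofReal (B z ^ 2 * p z.1 z.2) ∂M
      ≤ ENNReal.ofReal (16 / 15 * T ^ 5 * (K + 10 / T ^ 2)) := by
    rw [hM, lintegral_prod _ (by fun_prop), ← hQ, ofReal_integral_eq_lintegral_ofReal
      (hII (by fun_prop)) (.of_forall fun t => by positivity)]
    refine setLIntegral_mono' measurableSet_Ioc fun t ht => ?_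
    have := h.measurable_score_apply t
    rw [← h.lintegral_modelLaw t (f := fun y => B (t, y) ^ 2) (by fun_prop)]
    simp only [hB]
    rw [h.lintegral_affine_score_sq]
    refine ENNReal.ofReal_le_ofReal ?_
    rw [neg_sq]
    gcongr
    exact hK t (hsub t ht)
  have iA : Integrable (fun z => A z ^ 2 * p z.1 z.2) M := by
    refine ⟨by fun_prop, ?_⟩
    rw [hasFiniteIntegral_iff_ofReal (.of_forall fun z => mul_nonneg (sq_nonneg _) (hp0 z))]
    exact lA.trans_lt ENNReal.ofReal_lt_top
  have iB : Integrable (fun z => B z ^ 2 * p z.1 z.2) M := by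
    refine ⟨by fun_prop, ?_⟩
    rw [hasFiniteIntegral_iff_ofReal (.of_forall fun z => mul_nonneg (sq_nonneg _) (hp0 z))]
    exact lB.trans_lt ENNReal.ofReal_lt_top
  have iAB : Integrable (fun z => A z * B z * p z.1 z.2) M := by
    refine (iA.add iB).mono' (by fun_prop) (.of_forall fun z => ?_)
    rw [Real.norm_eq_abs, abs_mul, abs_of_nonneg (hp0 z), Pi.add_apply, ← add_mul]
    refine mul_le_mul_of_nonneg_right ?_ (hp0 z)
    rw [abs_le]
    constructor <;> nlinarith [sq_nonneg (A z + B z), sq_nonneg (A z - B z)]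
  have bA : ∫ z, A z ^ 2 * p z.1 z.2 ∂M ≤ r * (16 / 15 * T ^ 5) := by
    rw [integral_eq_lintegral_of_nonneg_ae
      (.of_forall fun z => mul_nonneg (sq_nonneg _) (hp0 z)) (by fun_prop)]
    exact ENNReal.toReal_le_of_le_ofReal (by positivity) lA
  have bB : ∫ z, B z ^ 2 * p z.1 z.2 ∂M ≤ 16 / 15 * T ^ 5 * (K + 10 / T ^ 2) := by
    rw [integral_eq_lintegral_of_nonneg_ae
      (.of_forall fun z => mul_nonneg (sq_nonneg _) (hp0 z)) (by fun_prop)]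
    exact ENNReal.toReal_le_of_le_ofReal (by positivity) lB
  -- the cross term
  have iW : Integrable (fun z : ℝ × Y => (T ^ 2 - z.1 ^ 2) ^ 2 * p z.1 z.2) M := by
    rw [hM, integrable_prod_iff (by fun_prop)]
    refine ⟨.of_forall fun t => (h.integrable_density t).const_mul ((T ^ 2 - t ^ 2) ^ 2), ?_⟩
    have e : ∀ t, ∫ y, ‖(T ^ 2 - t ^ 2) ^ 2 * p t y‖ ∂ν = (T ^ 2 - t ^ 2) ^ 2 := fun t => by
      simp_rw [norm_mul, Real.norm_of_nonneg (h.nonneg t _)]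
      rw [integral_const_mul, h.integral_density, Real.norm_of_nonneg (sq_nonneg _), mul_one]
    simp_rw [e]
    exact hII (by fun_prop)
  have bAB : ∫ z, A z * B z * p z.1 z.2 ∂M = 16 / 15 * T ^ 5 := by
    rw [hM, integral_prod_symm _ iAB]
    have e : ∀ y, ∫ t in I, A (t, y) * B (t, y) * p t y
        = ∫ t in I, (T ^ 2 - t ^ 2) ^ 2 * p t y := fun y => by
      rw [hI, ← intervalIntegral.integral_of_le hle, ← intervalIntegral.integral_of_le hle]
      exact h.intervalIntegral_weighted_score T (g y) y
    simp_rw [e]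
    rw [← integral_prod_symm (fun z : ℝ × Y => (T ^ 2 - z.1 ^ 2) ^ 2 * p z.1 z.2) iW,
      integral_prod _ iW]
    simp_rw [integral_const_mul, h.integral_density, mul_one]
    exact hW
  set L := K + 10 / T ^ 2 with hL
  have hL0 : 0 < L := by positivity
  have hsq : 0 ≤ ∫ z, (L * A z - B z) ^ 2 * p z.1 z.2 ∂M :=
    integral_nonneg fun z => mul_nonneg (sq_nonneg _) (hp0 z)
  have e : (fun z => (L * A z - B z) ^ 2 * p z.1 z.2) = fun z =>
      L ^ 2 * (A z ^ 2 * p z.1 z.2) - 2 * L * (A z * B z * p z.1 z.2) + B z ^ 2 * p z.1 z.2 := by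
    funext z; ring
  have iC : Integrable (fun z => L ^ 2 * (A z ^ 2 * p z.1 z.2)
      - 2 * L * (A z * B z * p z.1 z.2)) M := (iA.const_mul _).sub (iAB.const_mul _)
  rw [e, integral_add iC iB,
    integral_sub (iA.const_mul _) (iAB.const_mul _), integral_const_mul, integral_const_mul,
    bAB] at hsq
  rw [hRr]
  refine ENNReal.ofReal_le_ofReal ?_
  have hW0 : 0 < 16 / 15 * T ^ 5 := by positivity
  have h1 : L ^ 2 * ∫ z, A z ^ 2 * p z.1 z.2 ∂M ≤ L ^ 2 * (r * (16 / 15 * T ^ 5)) := by gcongr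
  have h2 : 0 ≤ (16 / 15 * T ^ 5 * L) * (L * r - 1) := by nlinarith
  have h3 : 0 ≤ L * r - 1 := nonneg_of_mul_nonneg_right h2 (by positivity)
  rw [div_le_iff₀ hL0]
  linarith

section Product

variable {ι : Type*} [Fintype ι] {Y : ι → Type*} [∀ i, MeasurableSpace (Y i)]
  {ν : ∀ i, Measure (Y i)} [∀ i, SigmaFinite (ν i)] {p s : ∀ i, ℝ → Y i → ℝ} {J : ι → ℝ → ℝ}

lemma modelLaw_pi (h : ∀ i, IsRegularModel (ν i) (p i) (s i) (J i)) (t : ℝ) :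
    modelLaw (Measure.pi ν) (fun t y => ∏ i, p i t (y i)) t
      = Measure.pi fun i => modelLaw (ν i) (p i) t := by
  have hp : ∀ i, IsProbabilityMeasure (modelLaw (ν i) (p i) t) := fun i =>
    (h i).isProbabilityMeasure t
  refine (Measure.pi_eq fun B hB => ?_).symm
  have hi : ∀ i, Integrable (p i t) ((ν i).restrict (B i)) := fun i =>
    ((h i).integrable_density t).integrableOn
  rw [modelLaw, withDensity_apply _ (MeasurableSet.univ_pi hB), Measure.restrict_pi_pi,
    ← ofReal_integral_eq_lintegral_ofReal (Integrable.fintype_prod_dep hi)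
      (.of_forall fun y => Finset.prod_nonneg fun i _ => (h i).nonneg t (y i)),
    integral_fintype_prod_eq_prod, ENNReal.ofReal_prod_of_nonneg
      (fun i _ => integral_nonneg ((h i).nonneg t))]
  refine Finset.prod_congr rfl fun i _ => ?_
  rw [modelLaw, withDensity_apply _ (hB i), ← ofReal_integral_eq_lintegral_ofReal (hi i)
    (.of_forall ((h i).nonneg t))]

theorem IsRegularModel.pi (h : ∀ i, IsRegularModel (ν i) (p i) (s i) (J i)) :
    IsRegularModel (Measure.pi ν) (fun t y => ∏ i, p i t (y i)) (fun t y => ∑ i, s i t (y i))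
      (fun t => ∑ i, J i t) := by
  classical
  have hp : ∀ t i, IsProbabilityMeasure (modelLaw (ν i) (p i) t) := fun t i =>
    (h i).isProbabilityMeasure t
  have hm : ∀ t i, MemLp (fun y : ∀ i, Y i => s i t (y i)) 2
      (Measure.pi fun i => modelLaw (ν i) (p i) t) := fun t i =>
    ((h i).memLp_score t).comp_measurePreserving (measurePreserving_eval _ i)
  have h0 : ∀ t, ∫ y, ∑ i, s i t (y i) ∂(Measure.pi fun i => modelLaw (ν i) (p i) t) = 0 := by
    intro t
    rw [integral_finsetSum _ fun i _ => (hm t i).integrable (by norm_num)]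
    refine Finset.sum_eq_zero fun i _ => ?_
    rw [← (h i).integral_score t,
      ← (measurePreserving_eval (fun i => modelLaw (ν i) (p i) t) i).map_eq,
      integral_map (measurable_pi_apply i).aemeasurable
        ((h i).measurable_score_apply t).aestronglyMeasurable]
  have hs : ∀ t, MemLp (fun y : ∀ i, Y i => ∑ i, s i t (y i)) 2
      (Measure.pi fun i => modelLaw (ν i) (p i) t) := fun t =>
    memLp_finsetSum _ fun i _ => hm t i
  refine ⟨fun t y => Finset.prod_nonneg fun i _ => (h i).nonneg t (y i), ?_, ?_, ?_, ?_, ?_, ?_,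
    ?_, ?_⟩
  · refine Finset.measurable_prod _ fun i _ => ?_
    exact (h i).measurable_density.comp
      (measurable_fst.prodMk ((measurable_pi_apply i).comp measurable_snd))
  · refine Finset.measurable_sum _ fun i _ => ?_
    exact (h i).measurable_score.comp
      (measurable_fst.prodMk ((measurable_pi_apply i).comp measurable_snd))
  · intro t y
    convert! HasDerivAt.fun_finsetProd (u := Finset.univ) (fun i _ => (h i).hasDerivAt t (y i))
      using 1
    rw [Finset.sum_mul]
    refine Finset.sum_congr rfl fun i _ => ?_
    rw [← Finset.mul_prod_erase _ _ (Finset.mem_univ i), smul_eq_mul]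
    ring
  · exact fun y => continuous_finsetSum _ fun i _ => (h i).continuous_score (y i)
  · intro t
    rw [modelLaw_pi h]
    infer_instance
  · intro t
    rw [modelLaw_pi h]
    exact hs t
  · intro t
    rw [modelLaw_pi h]
    exact h0 t
  · intro t
    rw [modelLaw_pi h, ← variance_of_integral_eq_zero (hs t).aemeasurable (h0 t)]
    have := variance_sum_pi (fun i => (h i).memLp_score t)
    rw [show (fun y : ∀ i, Y i => ∑ i, s i t (y i)) = ∑ i, fun y : ∀ i, Y i => s i t (y i) by
      ext; simp, this]
    refine Finset.sum_congr rfl fun i _ => ?_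
    rw [variance_of_integral_eq_zero ((h i).memLp_score t).aemeasurable ((h i).integral_score t),
      (h i).integral_score_sq]

end Product

lemma iteratedDeriv_exp_half_sq (n : ℕ) (q : ℕ → ℝ → ℝ) (q' : ℕ → ℝ → ℝ) (h0 : q 0 = 1)
    (hq : ∀ k t, HasDerivAt (q k) (q' k t) t) (hs : ∀ k < n, ∀ t, q (k + 1) t = q' k t + t * q k t)
    {k : ℕ} (hk : k ≤ n) :
    iteratedDeriv k (fun t : ℝ => Real.exp (t ^ 2 / 2)) = fun t => q k t * Real.exp (t ^ 2 / 2) := by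
  induction k with
  | zero => simp [h0]
  | succ k ih =>
    rw [iteratedDeriv_succ, ih (by omega)]
    funext t
    have h1 : HasDerivAt (fun t : ℝ => Real.exp (t ^ 2 / 2)) (Real.exp (t ^ 2 / 2) * t) t := by
      have := (((hasDerivAt_id t).pow 2).div_const 2).exp
      convert! this using 1
      simp
    rw [((hq k t).fun_mul h1).deriv, hs k (by omega)]
    ring

lemma integral_pow_stdGaussianReal :
    ∫ z, z ^ 1 ∂(gaussianReal 0 1) = 0 ∧ ∫ z, z ^ 2 ∂(gaussianReal 0 1) = 1 ∧
      ∫ z, z ^ 3 ∂(gaussianReal 0 1) = 0 ∧ ∫ z, z ^ 4 ∂(gaussianReal 0 1) = 3 := by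
  have hmgf : mgf (fun z => z) (gaussianReal 0 1) = fun t : ℝ => Real.exp (t ^ 2 / 2) := by
    rw [mgf_fun_id_gaussianReal]; simp
  have h1 : ∀ k, ∫ z, z ^ k ∂(gaussianReal 0 1)
      = iteratedDeriv k (mgf (fun z => z) (gaussianReal 0 1)) 0 := fun k =>
    (iteratedDeriv_mgf_zero (X := fun z : ℝ => z) (μ := gaussianReal 0 1) (by simp) k).symm
  let q : ℕ → ℝ → ℝ := fun k t =>
    match k with
    | 0 => 1
    | 1 => t
    | 2 => t ^ 2 + 1
    | 3 => t ^ 3 + 3 * t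
    | 4 => t ^ 4 + 6 * t ^ 2 + 3
    | _ => 0
  let q' : ℕ → ℝ → ℝ := fun k t =>
    match k with
    | 0 => 0
    | 1 => 1
    | 2 => 2 * t
    | 3 => 3 * t ^ 2 + 3
    | 4 => 4 * t ^ 3 + 12 * t
    | _ => 0
  have hq : ∀ k t, HasDerivAt (q k) (q' k t) t := by
    intro k t
    match k with
    | 0 => exact hasDerivAt_const t 1
    | 1 => exact hasDerivAt_id t
    | 2 =>
      convert! (hasDerivAt_pow 2 t).add_const (1 : ℝ) using 1
      simp [q']
    | 3 => simpa using! (hasDerivAt_pow 3 t).add ((hasDerivAt_id t).const_mul (3 : ℝ))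
    | 4 =>
      have := ((hasDerivAt_pow 4 t).add ((hasDerivAt_pow 2 t).const_mul (6 : ℝ))).add_const (3 : ℝ)
      convert! this using 1
      simp only [q']
      push_cast
      ring
    | k + 5 => exact hasDerivAt_const t 0
  have hs : ∀ k < 4, ∀ t, q (k + 1) t = q' k t + t * q k t := by
    intro k hk t
    interval_cases k <;> simp only [q, q'] <;> ring
  have h2 : ∀ k ≤ 4, ∫ z, z ^ k ∂(gaussianReal 0 1) = q k 0 := fun k hk => by
    rw [h1, hmgf, iteratedDeriv_exp_half_sq 4 q q' rfl hq hs hk]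
    simp
  refine ⟨?_, ?_, ?_, ?_⟩ <;> rw [h2 _ (by norm_num)] <;> simp [q]

lemma integrable_pow_stdGaussianReal (k : ℕ) :
    Integrable (fun z : ℝ => z ^ k) (gaussianReal 0 1) := by
  have h := memLp_id_gaussianReal (μ := 0) (v := 1) k
  have := h.integrable_norm_pow'
  exact this.mono (by fun_prop) (.of_forall fun z => by simp)

/-- The score of `N(m, v)` along a curve with velocity `(m', v')`. -/
def gaussianScore (m v m' v' y : ℝ) : ℝ :=
  (y - m) * m' / v + ((y - m) ^ 2 - v) * v' / (2 * v ^ 2)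

lemma map_stdGaussianReal (m : ℝ) {v : ℝ} (hv : 0 ≤ v) :
    (gaussianReal 0 1).map (fun z => m + √v * z) = gaussianReal m v.toNNReal := by
  have e : (fun z => m + √v * z) = (fun z => m + z) ∘ fun z => √v * z := rfl
  rw [e, ← Measure.map_map (by fun_prop) (by fun_prop), gaussianReal_map_const_mul,
    gaussianReal_map_const_add]
  congr 1
  · simp
  · ext
    simp [Real.sq_sqrt hv, hv]

lemma gaussianScore_standardize {m v m' v' : ℝ} (hv : 0 < v) (z : ℝ) :
    gaussianScore m v m' v' (m + √v * z)
      = m' / √v * z + v' / (2 * v) * z ^ 2 - v' / (2 * v) := by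
  have h : √v ^ 2 = v := Real.sq_sqrt hv.le
  have h0 : √v ≠ 0 := (Real.sqrt_pos.2 hv).ne'
  rw [gaussianScore]
  generalize √v = r at *
  subst h
  field_simp
  ring

lemma measurable_gaussianScore (m v m' v' : ℝ) : Measurable (gaussianScore m v m' v') := by
  unfold gaussianScore
  fun_prop

section
variable {m v m' v' : ℝ}

lemma gaussianScore_sq_standardize (hv : 0 < v) (z : ℝ) :
    gaussianScore m v m' v' (m + √v * z) ^ 2 = m' ^ 2 / v * z ^ 2 +
      (v' / (2 * v)) ^ 2 * (z ^ 4 - 2 * z ^ 2 + 1)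
      + 2 * (m' / √v) * (v' / (2 * v)) * (z ^ 3 - z ^ 1) := by
  have : (m' / √v) ^ 2 = m' ^ 2 / v := by rw [div_pow, Real.sq_sqrt hv.le]
  rw [gaussianScore_standardize hv, ← this]
  ring

lemma memLp_gaussianScore (hv : 0 < v) :
    MemLp (gaussianScore m v m' v') 2 (gaussianReal m v.toNNReal) := by
  rw [memLp_two_iff_integrable_sq (measurable_gaussianScore ..).aestronglyMeasurable,
    ← map_stdGaussianReal m hv.le, integrable_map_measure
      ((measurable_gaussianScore ..).pow_const 2).aestronglyMeasurable (by fun_prop)]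
  simp only [Function.comp_def, gaussianScore_sq_standardize hv]
  have := integrable_pow_stdGaussianReal
  exact (((this 2).const_mul _).add ((((this 4).sub ((this 2).const_mul _)).add
    (integrable_const _)).const_mul _)).add (((this 3).sub (this 1)).const_mul _)

lemma integral_gaussianScore (hv : 0 < v) :
    ∫ y, gaussianScore m v m' v' y ∂(gaussianReal m v.toNNReal) = 0 := by
  rw [← map_stdGaussianReal m hv.le, integral_map (by fun_prop)
    (measurable_gaussianScore ..).aestronglyMeasurable]
  simp only [gaussianScore_standardize hv]
  have i1 : Integrable (fun z : ℝ => m' / √v * z) (gaussianReal 0 1) := by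
    simpa using (integrable_pow_stdGaussianReal 1).const_mul (m' / √v)
  have i2 := (integrable_pow_stdGaussianReal 2).const_mul (v' / (2 * v))
  have i12 : Integrable (fun z : ℝ => m' / √v * z + v' / (2 * v) * z ^ 2) (gaussianReal 0 1) :=
    i1.add i2
  rw [integral_sub i12 (integrable_const _), integral_add i1 i2, integral_const_mul,
    integral_const_mul, integral_pow_stdGaussianReal.2.1]
  simp

lemma integral_gaussianScore_sq (hv : 0 < v) :
    ∫ y, gaussianScore m v m' v' y ^ 2 ∂(gaussianReal m v.toNNReal)
      = m' ^ 2 / v + v' ^ 2 / (2 * v ^ 2) := by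
  rw [← map_stdGaussianReal m hv.le, integral_map (by fun_prop)
    ((measurable_gaussianScore ..).pow_const 2).aestronglyMeasurable]
  simp only [gaussianScore_sq_standardize hv]
  have ip := integrable_pow_stdGaussianReal
  have i2 := (ip 2).const_mul (m' ^ 2 / v)
  have i42 : Integrable (fun z : ℝ => z ^ 4 - 2 * z ^ 2) (gaussianReal 0 1) :=
    (ip 4).sub ((ip 2).const_mul _)
  have i421 : Integrable (fun z : ℝ => z ^ 4 - 2 * z ^ 2 + 1) (gaussianReal 0 1) :=
    i42.add (integrable_const _)
  have i31 : Integrable (fun z : ℝ => z ^ 3 - z ^ 1) (gaussianReal 0 1) := (ip 3).sub (ip 1)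
  have is : Integrable (fun z : ℝ => m' ^ 2 / v * z ^ 2 +
      (v' / (2 * v)) ^ 2 * (z ^ 4 - 2 * z ^ 2 + 1)) (gaussianReal 0 1) :=
    i2.add (i421.const_mul _)
  rw [integral_add is (i31.const_mul _), integral_add i2 (i421.const_mul _), integral_const_mul,
    integral_const_mul, integral_const_mul, integral_add i42 (integrable_const _),
    integral_sub (ip 4) ((ip 2).const_mul _), integral_const_mul, integral_sub (ip 3) (ip 1),
    integral_pow_stdGaussianReal.1,
    integral_pow_stdGaussianReal.2.1,
    integral_pow_stdGaussianReal.2.2.1,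
    integral_pow_stdGaussianReal.2.2.2]
  simp
  field_simp
  ring

end

lemma gaussianPDFReal_eq_exp (m : ℝ) {v : ℝ} (hv : 0 < v) (y : ℝ) :
    gaussianPDFReal m v.toNNReal y
      = Real.exp (-(Real.log (2 * Real.pi * v) / 2) - (y - m) ^ 2 / (2 * v)) := by
  have h : 0 < 2 * Real.pi * v := by positivity
  rw [gaussianPDFReal, Real.coe_toNNReal _ hv.le, sub_eq_add_neg (-_), Real.exp_add, Real.exp_neg,
    Real.exp_half, Real.exp_log h, neg_div]

section Curve

variable {m v m' v' : ℝ → ℝ}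

lemma modelLaw_gaussian (hv : ∀ t, 0 < v t) (t : ℝ) :
    modelLaw volume (fun t => gaussianPDFReal (m t) (v t).toNNReal) t
      = gaussianReal (m t) (v t).toNNReal := by
  rw [gaussianReal_of_var_ne_zero _ (by simpa using hv t)]
  rfl

theorem isRegularModel_gaussian (hv : ∀ t, 0 < v t) (hm' : ∀ t, HasDerivAt m (m' t) t)
    (hv' : ∀ t, HasDerivAt v (v' t) t) (cm : Continuous m') (cv : Continuous v') :
    IsRegularModel volume (fun t => gaussianPDFReal (m t) (v t).toNNReal)
      (fun t => gaussianScore (m t) (v t) (m' t) (v' t))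
      (fun t => m' t ^ 2 / v t + v' t ^ 2 / (2 * v t ^ 2)) := by
  have hm : Continuous m := continuous_iff_continuousAt.2 fun t => (hm' t).continuousAt
  have hvc : Continuous v := continuous_iff_continuousAt.2 fun t => (hv' t).continuousAt
  refine ⟨fun t y => gaussianPDFReal_nonneg _ _ _, ?_, ?_, ?_, ?_, ?_, ?_, ?_, ?_⟩
  · have : Measurable fun z : ℝ × ℝ => (m z.1, (v z.1).toNNReal, z.2) := by fun_prop
    exact measurable_uncurry_gaussianPDFReal.comp this
  · simp only [Function.uncurry_def, gaussianScore]
    fun_prop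
  · intro t y
    have e : (fun t => gaussianPDFReal (m t) (v t).toNNReal y) = fun t =>
        Real.exp (-(Real.log (2 * Real.pi * v t) / 2) - (y - m t) ^ 2 / (2 * v t)) :=
      funext fun t => gaussianPDFReal_eq_exp _ (hv t) y
    rw [e, gaussianPDFReal_eq_exp _ (hv t)]
    have hv0 := (hv t).ne'
    have h2 : 2 * Real.pi * v t ≠ 0 := by have := hv t; positivity
    have := (((((hv' t).const_mul (2 * Real.pi)).log h2).div_const 2).neg.sub
      ((((hm' t).const_sub y).pow 2).div ((hv' t).const_mul 2) (by simpa using hv0))).exp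
    convert! this using 1
    rw [mul_comm, gaussianScore]
    congr 1
    simp only [Pi.pow_apply]
    field_simp
    push_cast
    ring
  · intro y
    simp only [gaussianScore]
    refine Continuous.add (Continuous.div (by fun_prop) hvc fun t => (hv t).ne')
      (Continuous.div (by fun_prop) (by fun_prop) fun t => ?_)
    have := hv t
    positivity
  · intro t
    rw [modelLaw_gaussian hv]
    infer_instance
  · intro t
    rw [modelLaw_gaussian hv]
    exact memLp_gaussianScore (hv t)
  · intro t
    rw [modelLaw_gaussian hv]
    exact integral_gaussianScore (hv t)
  · intro t
    rw [modelLaw_gaussian hv]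
    exact integral_gaussianScore_sq (hv t)

end Curve

lemma multivariateGaussian_map_inner {ι : Type*} [Fintype ι] [DecidableEq ι]
    (μ a : EuclideanSpace ℝ ι) {S : Matrix ι ι ℝ} (hS : S.PosSemidef) :
    (multivariateGaussian μ S).map (fun x => inner ℝ x a)
      = gaussianReal (inner ℝ μ a) (a.ofLp ⬝ᵥ S *ᵥ a.ofLp).toNNReal := by
  have h := IsGaussian.map_eq_gaussianReal (μ := multivariateGaussian μ S) (innerSL ℝ a)
  have e : (innerSL ℝ a : EuclideanSpace ℝ ι → ℝ) = fun x => inner ℝ x a := by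
    ext x; simp [real_inner_comm]
  have hv := covarianceBilin_multivariateGaussian (μ := μ) hS a a
  rw [covarianceBilin_self IsGaussian.memLp_two_id] at hv
  simp_rw [real_inner_comm _ a] at hv
  rw [ContinuousLinearMap.integral_comp_id_comm IsGaussian.integrable_id,
    integral_id_multivariateGaussian, e, hv] at h
  simpa only [real_inner_comm] using! h

namespace AgentView

variable {d : ℕ} (V : AgentView d) {S : Matrix (Fin d) (Fin d) ℝ}

lemma blockPlus_posDef (hS : S.PosDef) : (V.blockPlus S).PosDef :=
  hS.submatrix (V.perm.injective.comp Sum.inl_injective)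

lemma blockPM_conjTranspose (hS : S.PosDef) : (V.blockPM S)ᴴ = V.blockMP S := by
  rw [blockPM, Matrix.conjTranspose_submatrix, hS.isHermitian.eq, blockMP]

lemma submatrix_perm (S : Matrix (Fin d) (Fin d) ℝ) : S.submatrix V.perm V.perm
    = Matrix.fromBlocks (V.blockPlus S) (V.blockPM S) (V.blockMP S) (V.blockMinus S) := by
  ext i j
  rcases i with i | i <;> rcases j with j | j <;> rfl

lemma schur_posSemidef (hS : S.PosDef) : (V.schur S).PosSemidef := by
  have hP := V.blockPlus_posDef hS
  have := hP.isUnit.invertible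
  have h := hS.posSemidef.submatrix V.perm
  rw [submatrix_perm, ← V.blockPM_conjTranspose hS, hP.fromBlocks₁₁] at h
  rw [schur, ← V.blockPM_conjTranspose hS]
  exact h

lemma T_mulVec (v : EuclideanSpace ℝ (Fin d)) : V.T S *ᵥ v.ofLp
    = (V.obs v).ofLp + ((V.blockPlus S)⁻¹ * V.blockPM S) *ᵥ (V.mis v).ofLp := by
  have e : v.ofLp ∘ V.perm = Sum.elim (V.obs v).ofLp (V.mis v).ofLp := by
    ext i
    rcases i with i | i <;> rfl
  rw [T, Matrix.submatrix_mulVec_equiv, Equiv.symm_symm, e, Matrix.fromCols_mulVec_sumElim]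
  simp

/-- The Schur decomposition of the quadratic form of `S`. -/
lemma quadratic_decomposition (hS : S.PosDef) (v : EuclideanSpace ℝ (Fin d)) :
    v.ofLp ⬝ᵥ S *ᵥ v.ofLp = (V.T S *ᵥ v.ofLp) ⬝ᵥ V.blockPlus S *ᵥ (V.T S *ᵥ v.ofLp)
      + (V.mis v).ofLp ⬝ᵥ V.schur S *ᵥ (V.mis v).ofLp := by
  have hP := V.blockPlus_posDef hS
  have := hP.isUnit.invertible
  have h := Matrix.schur_complement_eq₁₁ (V.blockPM S) (V.blockMinus S) (V.obs v).ofLp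
    (V.mis v).ofLp hP.isHermitian
  rw [V.blockPM_conjTranspose hS, ← submatrix_perm, ← T_mulVec] at h
  have e : v.ofLp ∘ V.perm = Sum.elim (V.obs v).ofLp (V.mis v).ofLp := by
    ext i
    rcases i with i | i <;> rfl
  simp only [star_trivial, ← e, ← Matrix.dotProduct_mulVec] at h
  rw [schur, ← h, Matrix.submatrix_mulVec_equiv]
  rw [show (v.ofLp ∘ V.perm) ∘ V.perm.symm = v.ofLp by ext; simp]
  exact (Equiv.sum_comp V.perm fun i => v.ofLp i * (S *ᵥ v.ofLp) i).symm

lemma inner_condMean (hS : S.PosDef) (θ : EuclideanSpace ℝ (Fin d))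
    (x : EuclideanSpace ℝ (Fin V.numObs)) :
    inner ℝ x (V.obs θ) + inner ℝ (V.condMean S x) (V.mis θ)
      = inner ℝ x (WithLp.toLp 2 (V.T S *ᵥ θ.ofLp)) := by
  have hP := V.blockPlus_posDef hS
  have e : (V.blockMP S * (V.blockPlus S)⁻¹) = ((V.blockPlus S)⁻¹ * V.blockPM S)ᵀ := by
    rw [← V.blockPM_conjTranspose hS, Matrix.transpose_mul,
      ← Matrix.conjTranspose_eq_transpose_of_trivial (V.blockPlus S)⁻¹,
      hP.isHermitian.inv.eq, Matrix.conjTranspose_eq_transpose_of_trivial]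
  rw [T_mulVec, WithLp.toLp_add, inner_add_right]
  simp only [EuclideanSpace.inner_eq_star_dotProduct, star_trivial, condMean, e]
  congr 1
  rw [Matrix.mulVec_transpose, dotProduct_comm, dotProduct_comm _ x.ofLp,
    Matrix.dotProduct_mulVec]

lemma misVar_nonneg (hS : S.PosDef) (θ : EuclideanSpace ℝ (Fin d)) : 0 ≤ V.misVar S θ := by
  have h := (V.schur_posSemidef hS).dotProduct_mulVec_nonneg (V.mis θ).ofLp
  rwa [star_trivial] at h

lemma labelLaw_eq_gaussianReal (hS : S.PosDef) (σ : ℝ) (θ : EuclideanSpace ℝ (Fin d))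
    (x : EuclideanSpace ℝ (Fin V.numObs)) :
    V.labelLaw S σ θ x = gaussianReal (inner ℝ x (WithLp.toLp 2 (V.T S *ᵥ θ.ofLp)))
      (V.misVar S θ + σ ^ 2).toNNReal := by
  set μ := multivariateGaussian (V.condMean S x) (V.schur S) with hμ
  set γ := gaussianReal 0 (σ ^ 2).toNNReal with hγ
  have h1 : (μ.prod γ).map (fun p => inner ℝ p.1 (V.mis θ) + p.2)
      = gaussianReal (inner ℝ (V.condMean S x) (V.mis θ) + 0)
        ((V.misVar S θ).toNNReal + (σ ^ 2).toNNReal) := by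
    rw [← gaussianReal_conv_gaussianReal, misVar,
      ← multivariateGaussian_map_inner _ _ (V.schur_posSemidef hS), Measure.conv]
    have h2 := Measure.map_prod_map μ γ (f := fun x => inner ℝ x (V.mis θ)) (g := id)
      (by fun_prop) measurable_id
    rw [Measure.map_id] at h2
    rw [h2, Measure.map_map (by fun_prop) (by fun_prop)]
    rfl
  have e : (fun p : EuclideanSpace ℝ (Fin V.numMis) × ℝ =>
      inner ℝ x (V.obs θ) + inner ℝ p.1 (V.mis θ) + p.2)
      = (fun y => inner ℝ x (V.obs θ) + y) ∘ fun p => inner ℝ p.1 (V.mis θ) + p.2 := by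
    ext p; simp [add_assoc]
  rw [labelLaw, e, ← Measure.map_map (by fun_prop) (by fun_prop), h1, gaussianReal_map_const_add,
    ← inner_condMean V hS, Real.toNNReal_add (V.misVar_nonneg hS θ) (sq_nonneg σ)]
  congr 1
  ring

end AgentView

open Topology in
lemma HasDerivAt.eventually_nhdsGT_lt {f : ℝ → ℝ} {f' x : ℝ} (h : HasDerivAt f f' x)
    (hf : f' < 0) : ∀ᶠ y in 𝓝[>] x, f y < f x := by
  have h1 := (hasDerivAt_iff_tendsto_slope.1 h).mono_left
    (nhdsWithin_mono x (fun y (hy : x < y) => hy.ne'))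
  filter_upwards [h1.eventually_lt_const hf, self_mem_nhdsWithin] with y hy hxy
  have hxy : 0 < y - x := sub_pos.2 hxy
  rw [slope_def_field, div_neg_iff] at hy
  rcases hy with hy | hy <;> linarith

lemma integrable_exp_mul_sq_gaussianReal {s : ℝ} (hs : s < 1 / 2) :
    Integrable (fun z : ℝ => Real.exp (s * z ^ 2)) (gaussianReal 0 1) := by
  rw [gaussianReal_of_var_ne_zero _ one_ne_zero, integrable_withDensity_iff_integrable_smul'
    (measurable_gaussianPDF 0 1) (.of_forall fun z => gaussianPDF_lt_top)]
  have h := (integrable_exp_neg_mul_sq (b := 1 / 2 - s) (by linarith)).const_mul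
    (√(2 * Real.pi))⁻¹
  refine h.congr (.of_forall fun z => ?_)
  simp only [toReal_gaussianPDF, gaussianPDFReal, smul_eq_mul, mul_assoc, ← Real.exp_add]
  congr 2
  · simp
  · simp only [sub_zero, NNReal.coe_one]
    ring

lemma exists_chiSq_rate {v δ : ℝ} (hδ : 0 < δ) :
    ∃ s, 0 < s ∧ s * v < 1 / 2 ∧
      Real.exp (-s * (v + δ)) * mgf (fun z => z ^ 2) (gaussianReal 0 1) (s * v) < 1 := by
  have h0 : (0 : ℝ) ∈ interior (integrableExpSet (fun z : ℝ => z ^ 2) (gaussianReal 0 1)) :=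
    mem_interior.2 ⟨Set.Iio (1 / 2), fun s hs => integrable_exp_mul_sq_gaussianReal hs,
      isOpen_Iio, by norm_num⟩
  have h1 := hasDerivAt_mgf h0
  have e1 : ∫ z : ℝ, z ^ 2 * Real.exp (0 * z ^ 2) ∂(gaussianReal 0 1) = 1 := by
    simpa using integral_pow_stdGaussianReal.2.1
  rw [e1] at h1
  have h2 : HasDerivAt (fun s : ℝ => s * v) v 0 := by
    simpa using (hasDerivAt_id (0 : ℝ)).mul_const v
  have h3 : HasDerivAt (fun s : ℝ => Real.exp (-s * (v + δ))) (-(v + δ)) 0 := by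
    have := ((hasDerivAt_neg (0 : ℝ)).mul_const (v + δ)).exp
    convert! this using 1
    simp
  have h4 := HasDerivAt.comp (0 : ℝ) (h₂ := mgf (fun z : ℝ => z ^ 2) (gaussianReal 0 1))
    (by simpa using h1) h2
  have h5 := h3.fun_mul h4
  have h6 := h5.eventually_nhdsGT_lt (by simp; exact hδ)
  have h7 : ∀ᶠ s : ℝ in nhdsWithin 0 (Set.Ioi 0), s * v < 1 / 2 :=
    (h2.continuousAt.tendsto.mono_left nhdsWithin_le_nhds).eventually_lt_const (by norm_num)
  obtain ⟨s, hs, hs', hs''⟩ := (h6.and (h7.and self_mem_nhdsWithin)).exists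
  exact ⟨s, hs'', hs', by simpa using hs⟩

section
variable {Ω : Type*} [MeasurableSpace Ω] {P : Measure Ω} {v : ℝ}

lemma ProbabilityTheory.HasLaw.integrable_exp_mul_sq {G : Ω → ℝ} (hv : 0 ≤ v)
    (hG : HasLaw G (gaussianReal 0 v.toNNReal) P) {s : ℝ} (hs : s * v < 1 / 2) :
    Integrable (fun ω => Real.exp (s * G ω ^ 2)) P := by
  have h : Integrable (fun z : ℝ => Real.exp (s * z ^ 2)) (P.map G) := by
    rw [hG.map_eq, ← map_stdGaussianReal 0 hv, integrable_map_measure (by fun_prop) (by fun_prop)]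
    refine (integrable_exp_mul_sq_gaussianReal hs).congr (.of_forall fun z => ?_)
    simp only [Function.comp_apply, zero_add, mul_pow, Real.sq_sqrt hv, mul_assoc]
  exact h.comp_aemeasurable hG.aemeasurable

lemma ProbabilityTheory.HasLaw.mgf_sq {G : Ω → ℝ} (hv : 0 ≤ v)
    (hG : HasLaw G (gaussianReal 0 v.toNNReal) P) (s : ℝ) :
    mgf (fun ω => G ω ^ 2) P s = mgf (fun z => z ^ 2) (gaussianReal 0 1) (s * v) := by
  have h : mgf (fun z : ℝ => z ^ 2) (P.map G) s = mgf (fun ω => G ω ^ 2) P s :=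
    mgf_map hG.aemeasurable (by fun_prop)
  rw [← h, hG.map_eq, ← map_stdGaussianReal 0 hv, mgf_map (by fun_prop) (by fun_prop), mgf, mgf]
  simp only [Function.comp_apply, zero_add, mul_pow, Real.sq_sqrt hv, mul_assoc]

/-- One-sided strong law for the squares of a triangular array of Gaussian variables. -/
lemma ae_eventually_sum_sq_le (hv : 0 ≤ v) {G : (n : ℕ) → Fin n → Ω → ℝ}
    (hlaw : ∀ n k, HasLaw (G n k) (gaussianReal 0 v.toNNReal) P)
    [IsProbabilityMeasure P] (hindep : ∀ n, iIndepFun (G n) P) :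
    ∀ᵐ ω ∂P, ∀ δ > 0, ∀ᶠ n : ℕ in atTop, ∑ k, G n k ω ^ 2 ≤ n * (v + δ) := by
  have key : ∀ δ > 0, ∀ᵐ ω ∂P, ∀ᶠ n : ℕ in atTop, ∑ k, G n k ω ^ 2 ≤ n * (v + δ) := by
    intro δ hδ
    obtain ⟨s, hs0, hsv, hr⟩ := exists_chiSq_rate (v := v) hδ
    set r := Real.exp (-s * (v + δ)) * mgf (fun z => z ^ 2) (gaussianReal 0 1) (s * v) with hrdef
    have hr0 : 0 ≤ r := mul_nonneg (Real.exp_pos _).le mgf_nonneg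
    have hb : ∀ n : ℕ, P {ω | (n : ℝ) * (v + δ) ≤ (∑ k, fun ω => G n k ω ^ 2) ω}
        ≤ ENNReal.ofReal (r ^ n) := by
      intro n
      have hi : iIndepFun (fun k ω => G n k ω ^ 2) P :=
        (hindep n).comp (fun _ z => z ^ 2) fun _ => by fun_prop
      have hm : ∀ k, AEMeasurable (fun ω => G n k ω ^ 2) P := fun k =>
        (hlaw n k).aemeasurable.pow_const 2
      have hexp : Integrable (fun ω => Real.exp (s * (∑ k, fun ω => G n k ω ^ 2) ω)) P := by
        by_contra hcon
        have h0 := mgf_undef hcon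
        rw [hi.mgf_sum₀ hm] at h0
        exact (Finset.prod_pos fun k _ =>
          mgf_pos ((hlaw n k).integrable_exp_mul_sq hv hsv)).ne' h0
      have h := measure_ge_le_exp_mul_mgf (μ := P) (X := ∑ k, fun ω => G n k ω ^ 2)
        ((n : ℝ) * (v + δ)) hs0.le hexp
      rw [hi.mgf_sum₀ hm] at h
      simp only [fun k => (hlaw n k).mgf_sq hv s, Finset.prod_const, Finset.card_univ,
        Fintype.card_fin] at h
      rw [show -s * ((n : ℝ) * (v + δ)) = n * (-s * (v + δ)) by ring, Real.exp_nat_mul,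
        ← mul_pow] at h
      rw [← ofReal_measureReal]
      exact ENNReal.ofReal_le_ofReal h
    have hsum : ∑' n : ℕ, P {ω | (n : ℝ) * (v + δ) ≤ (∑ k, fun ω => G n k ω ^ 2) ω} ≠ ∞ := by
      refine ne_top_of_le_ne_top ?_ (ENNReal.tsum_le_tsum hb)
      rw [← ENNReal.ofReal_tsum_of_nonneg (fun n => pow_nonneg hr0 n)
        (summable_geometric_of_lt_one hr0 hr)]
      exact ENNReal.ofReal_ne_top
    filter_upwards [ae_eventually_notMem hsum] with ω hω
    filter_upwards [hω] with n hn
    simp only [not_le, Finset.sum_apply] at hn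
    exact hn.le
  have h2 := ae_all_iff.2 fun j : ℕ => key (1 / (j + 1 : ℝ)) (by positivity)
  filter_upwards [h2] with ω hω δ hδ
  obtain ⟨j, hj⟩ := exists_nat_one_div_lt hδ
  filter_upwards [hω j] with n hn
  refine hn.trans ?_
  gcongr

end

namespace AgentView

variable {d : ℕ} (V : AgentView d) {S : Matrix (Fin d) (Fin d) ℝ}

/-- The polar form of `misVar`. -/
def misCov (S : Matrix (Fin d) (Fin d) ℝ) (θ h : EuclideanSpace ℝ (Fin d)) : ℝ :=
  (V.mis θ).ofLp ⬝ᵥ (V.schur S *ᵥ (V.mis h).ofLp)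

lemma misVar_add_smul (hS : S.PosDef) (θ h : EuclideanSpace ℝ (Fin d)) (t : ℝ) :
    V.misVar S (θ + t • h) = V.misVar S θ + 2 * t * V.misCov S θ h + t ^ 2 * V.misVar S h := by
  have e : (V.mis (θ + t • h)).ofLp = (V.mis θ).ofLp + t • (V.mis h).ofLp := rfl
  have hsym : (V.mis h).ofLp ⬝ᵥ V.schur S *ᵥ (V.mis θ).ofLp = V.misCov S θ h := by
    have := (V.schur_posSemidef hS).isHermitian.eq
    rw [Matrix.conjTranspose_eq_transpose_of_trivial] at this
    rw [misCov, Matrix.dotProduct_mulVec, ← Matrix.mulVec_transpose, this, dotProduct_comm]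
  rw [misVar, e, Matrix.mulVec_add, Matrix.mulVec_smul, add_dotProduct, dotProduct_add,
    dotProduct_add, smul_dotProduct, smul_dotProduct, dotProduct_smul, dotProduct_smul, hsym,
    misVar, misVar, misCov]
  simp only [smul_eq_mul]
  ring

lemma misCov_sq_le (hS : S.PosDef) (θ h : EuclideanSpace ℝ (Fin d)) :
    V.misCov S θ h ^ 2 ≤ V.misVar S θ * V.misVar S h := by
  have h1 := discrim_le_zero (a := V.misVar S h) (b := 2 * V.misCov S θ h) (c := V.misVar S θ)
    fun t => by
      have := V.misVar_nonneg hS (θ + t • h)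
      rw [V.misVar_add_smul hS] at this
      linarith
  rw [discrim] at h1
  linarith

/-- The variance of a label along the line through `θ` with direction `h`. -/
def lineVar (S : Matrix (Fin d) (Fin d) ℝ) (σ : ℝ) (θ h : EuclideanSpace ℝ (Fin d)) (t : ℝ) : ℝ :=
  V.misVar S θ + 2 * t * V.misCov S θ h + t ^ 2 * V.misVar S h + σ ^ 2

/-- The derivative of `lineVar`. -/
def lineVarDeriv (S : Matrix (Fin d) (Fin d) ℝ) (θ h : EuclideanSpace ℝ (Fin d)) (t : ℝ) : ℝ :=
  2 * V.misCov S θ h + 2 * t * V.misVar S h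

variable {σ : ℝ} (θ h : EuclideanSpace ℝ (Fin d))

lemma lineVar_pos (hS : S.PosDef) (hσ : 0 < σ) (t : ℝ) : 0 < V.lineVar S σ θ h t := by
  rw [lineVar, ← V.misVar_add_smul hS]
  have := V.misVar_nonneg hS (θ + t • h)
  positivity

lemma hasDerivAt_lineVar (t : ℝ) :
    HasDerivAt (V.lineVar S σ θ h) (V.lineVarDeriv S θ h t) t := by
  have h1 := ((((hasDerivAt_id t).const_mul 2).mul_const (V.misCov S θ h)).const_add
    (V.misVar S θ)).add (((hasDerivAt_id t).pow 2).mul_const (V.misVar S h))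
  convert! h1.add_const (σ ^ 2) using 1
  simp [lineVarDeriv]

lemma continuous_lineVar : Continuous (V.lineVar S σ θ h) := by
  unfold lineVar
  fun_prop

lemma continuous_lineVarDeriv : Continuous (V.lineVarDeriv S θ h) := by
  unfold lineVarDeriv
  fun_prop

/-- Fisher information per sample along `h` is at most `2 hᵀ S h / (‖θ₋‖² + σ²)`. -/
lemma info_le (hS : S.PosDef) (hσ : 0 < σ) :
    (V.T S *ᵥ h.ofLp) ⬝ᵥ V.blockPlus S *ᵥ (V.T S *ᵥ h.ofLp) / V.lineVar S σ θ h 0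
      + V.lineVarDeriv S θ h 0 ^ 2 / (2 * V.lineVar S σ θ h 0 ^ 2)
    ≤ 2 / (V.misVar S θ + σ ^ 2) * (h.ofLp ⬝ᵥ S *ᵥ h.ofLp) := by
  have hv : 0 < V.misVar S θ + σ ^ 2 := by
    have := V.misVar_nonneg hS θ
    positivity
  have hq : 0 ≤ (V.T S *ᵥ h.ofLp) ⬝ᵥ V.blockPlus S *ᵥ (V.T S *ᵥ h.ofLp) := by
    have h := (V.blockPlus_posDef hS).posSemidef.dotProduct_mulVec_nonneg (V.T S *ᵥ h.ofLp)
    rwa [star_trivial] at h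
  have e0 : V.lineVar S σ θ h 0 = V.misVar S θ + σ ^ 2 := by simp [lineVar]
  have e1 : V.lineVarDeriv S θ h 0 = 2 * V.misCov S θ h := by simp [lineVarDeriv]
  have e2 : (V.mis h).ofLp ⬝ᵥ V.schur S *ᵥ (V.mis h).ofLp = V.misVar S h := rfl
  rw [V.quadratic_decomposition hS h, e0, e1, e2]
  set q := (V.T S *ᵥ h.ofLp) ⬝ᵥ V.blockPlus S *ᵥ (V.T S *ᵥ h.ofLp)
  have hc := V.misCov_sq_le hS θ h
  have hh := V.misVar_nonneg hS h
  set v := V.misVar S θ + σ ^ 2 with hvdef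
  have hc' : V.misCov S θ h ^ 2 ≤ v * V.misVar S h :=
    hc.trans (mul_le_mul_of_nonneg_right (by rw [hvdef]; nlinarith) hh)
  rw [div_add_div _ _ hv.ne' (by positivity), div_mul_eq_mul_div, div_le_div_iff₀ (by positivity) hv]
  nlinarith [mul_le_mul_of_nonneg_left hc' (sq_nonneg v), mul_nonneg hq (pow_pos hv 3).le]

end AgentView

section Submodel

variable {d m : ℕ} (V : Fin m → AgentView d) {S : Matrix (Fin d) (Fin d) ℝ} {σ : ℝ}
  (θ h : EuclideanSpace ℝ (Fin d))

/-- The labels along a line in the parameter space form a regular model. -/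
lemma exists_isRegularModel_labelsLaw (hS : S.PosDef) (hσ : 0 < σ) {n : ℕ} (x : ObsFeatures V n) :
    ∃ (ν : Measure (Labels m n)) (_ : SigmaFinite ν) (p s : ℝ → Labels m n → ℝ),
      IsRegularModel ν p s (fun t => ∑ i, ∑ k : Fin n,
        (inner ℝ (x i k) (WithLp.toLp 2 ((V i).T S *ᵥ h.ofLp)) ^ 2 / (V i).lineVar S σ θ h t
          + (V i).lineVarDeriv S θ h t ^ 2 / (2 * (V i).lineVar S σ θ h t ^ 2))) ∧
      ∀ t, modelLaw ν p t = labelsLaw V S σ x (θ + t • h) := by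
  have hm : ∀ i k t, HasDerivAt (fun t => inner ℝ (x i k) (WithLp.toLp 2 ((V i).T S *ᵥ θ.ofLp))
      + t * inner ℝ (x i k) (WithLp.toLp 2 ((V i).T S *ᵥ h.ofLp)))
      (inner ℝ (x i k) (WithLp.toLp 2 ((V i).T S *ᵥ h.ofLp))) t := fun i k t => by
    simpa using (hasDerivAt_mul_const
      (inner ℝ (x i k) (WithLp.toLp 2 ((V i).T S *ᵥ h.ofLp)))).const_add
      (inner ℝ (x i k) (WithLp.toLp 2 ((V i).T S *ᵥ θ.ofLp)))
  have h1 := fun i k => isRegularModel_gaussian (fun t => (V i).lineVar_pos θ h hS hσ t)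
    (hm i k) ((V i).hasDerivAt_lineVar θ h) continuous_const ((V i).continuous_lineVarDeriv θ h)
  have h2 := fun i => IsRegularModel.pi (h1 i)
  have h3 := IsRegularModel.pi h2
  refine ⟨_, inferInstance, _, _, h3, fun t => ?_⟩
  rw [modelLaw_pi h2, labelsLaw]
  congr 1
  funext i
  rw [modelLaw_pi (h1 i)]
  congr 1
  funext k
  rw [modelLaw_gaussian fun t => (V i).lineVar_pos θ h hS hσ t,
    (V i).labelLaw_eq_gaussianReal hS, AgentView.lineVar, (V i).misVar_add_smul hS]
  congr 1
  rw [WithLp.ofLp_add, WithLp.ofLp_smul, Matrix.mulVec_add, Matrix.mulVec_smul, WithLp.toLp_add,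
    WithLp.toLp_smul, inner_add_right, inner_smul_right]

/-- Lower bound on the local minimax risk from the one-dimensional submodel in direction `h`. -/
lemma le_localMinimaxRisk (hS : S.PosDef) (hσ : 0 < σ) {n s : ℕ} (hn : 0 < n)
    (x : ObsFeatures V n) {ψ : EuclideanSpace ℝ (Fin d) → EuclideanSpace ℝ (Fin s)}
    {u : EuclideanSpace ℝ (Fin s)} {w : EuclideanSpace ℝ (Fin d)}
    (hψ : ∀ θ', inner ℝ u (ψ θ') = inner ℝ w θ') (hwh : 0 < inner ℝ w h) {c K : ℝ} (hc : 0 < c)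
    (hK : ∀ t, |t| ≤ c / (√n * ‖h‖) → ∑ i, ∑ k : Fin n,
        (inner ℝ (x i k) (WithLp.toLp 2 ((V i).T S *ᵥ h.ofLp)) ^ 2 / (V i).lineVar S σ θ h t
          + (V i).lineVarDeriv S θ h t ^ 2 / (2 * (V i).lineVar S σ θ h t ^ 2)) ≤ n * K) :
    ENNReal.ofReal (inner ℝ w h ^ 2 / (K + 10 * ‖h‖ ^ 2 / c ^ 2))
      ≤ localMinimaxRisk V S σ ψ θ c n x u := by
  obtain ⟨ν, _, p, s, hreg, hlaw⟩ := exists_isRegularModel_labelsLaw V θ h hS hσ x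
  have hh : 0 < ‖h‖ := norm_pos_iff.2 fun h0 => by simp [h0] at hwh
  have hn' : (0 : ℝ) < n := by exact_mod_cast hn
  have hsn : 0 < √(n : ℝ) := Real.sqrt_pos.2 hn'
  set τ := inner ℝ w h with hτ
  set T := c / (√n * ‖h‖) with hT
  have hT0 : 0 < T := by positivity
  refine le_iInf₂ fun est hest => ?_
  set R := ⨆ θ' ∈ Metric.closedBall θ (c / √(n : ℝ)),
    (n : ℝ≥0∞) * ∫⁻ y, ENNReal.ofReal (inner ℝ u (est (y, x) - ψ θ') ^ 2)
      ∂(labelsLaw V S σ x θ') with hR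
  have hnτ : 0 < n * τ ^ 2 := by positivity
  have hg : Measurable fun y => (inner ℝ u (est (y, x)) - inner ℝ w θ) / τ := by fun_prop
  have hbound : ∀ t ∈ Set.Icc (-T) T,
      ∫⁻ y, ENNReal.ofReal (((inner ℝ u (est (y, x)) - inner ℝ w θ) / τ - t) ^ 2)
        ∂(modelLaw ν p t) ≤ R / ENNReal.ofReal (n * τ ^ 2) := by
    intro t ht
    rw [ENNReal.le_div_iff_mul_le (.inl (ENNReal.ofReal_pos.2 hnτ).ne') (.inl ENNReal.ofReal_ne_top),
      mul_comm, ENNReal.ofReal_mul hn'.le, ENNReal.ofReal_natCast, mul_assoc,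
      ← lintegral_const_mul _ (by fun_prop), hlaw]
    have hball : θ + t • h ∈ Metric.closedBall θ (c / √(n : ℝ)) := by
      rw [mem_closedBall_iff_norm, add_sub_cancel_left, norm_smul, Real.norm_eq_abs]
      calc |t| * ‖h‖ ≤ T * ‖h‖ := by gcongr; exact abs_le.2 ht
        _ = c / √(n : ℝ) := by rw [hT]; field_simp
    refine le_trans (le_of_eq ?_) (le_iSup₂_of_le _ hball le_rfl)
    congr 1
    refine lintegral_congr fun y => ?_
    rw [← ENNReal.ofReal_mul (sq_nonneg _), ← mul_pow, inner_sub_right, hψ, inner_add_right,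
      inner_smul_right, ← hτ]
    congr 2
    field_simp
    ring
  have key := hreg.vanTrees hT0 (fun t ht => hK t (abs_le.2 ht)) hg hbound
  rw [ENNReal.le_div_iff_mul_le (.inl (ENNReal.ofReal_pos.2 hnτ).ne') (.inl ENNReal.ofReal_ne_top),
    ← ENNReal.ofReal_mul' hnτ.le] at key
  refine le_trans (le_of_eq (congrArg _ ?_)) key
  have e : n * K + 10 / T ^ 2 = n * (K + 10 * ‖h‖ ^ 2 / c ^ 2) := by
    rw [hT, div_pow, mul_pow, Real.sq_sqrt hn'.le]
    field_simp
  rw [e, one_div, mul_inv, mul_comm (n : ℝ)⁻¹, mul_assoc, ← mul_assoc (n : ℝ)⁻¹,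
    inv_mul_cancel₀ hn'.ne', one_mul, div_eq_inv_mul]

end Submodel

section Asymptotic

variable {d m : ℕ} (V : Fin m → AgentView d) {S : Matrix (Fin d) (Fin d) ℝ} {σ : ℝ}
  (θ h : EuclideanSpace ℝ (Fin d))

/-- The asymptotic bound for feature sequences whose empirical second moments in the directions
`Tᵢ h` are asymptotically at most `qᵢ`. -/
lemma le_liminf_localMinimaxRisk (hS : S.PosDef) (hσ : 0 < σ) {s : ℕ}
    (x : (n : ℕ) → ObsFeatures V n) {ψ : EuclideanSpace ℝ (Fin d) → EuclideanSpace ℝ (Fin s)}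
    {u : EuclideanSpace ℝ (Fin s)} {w : EuclideanSpace ℝ (Fin d)}
    (hψ : ∀ θ', inner ℝ u (ψ θ') = inner ℝ w θ') (hwh : 0 < inner ℝ w h) {q : Fin m → ℝ}
    (hx : ∀ i, ∀ δ > 0, ∀ᶠ n : ℕ in atTop,
      ∑ k, inner ℝ (x n i k) (WithLp.toLp 2 ((V i).T S *ᵥ h.ofLp)) ^ 2 ≤ n * (q i + δ))
    (hq : ∑ i, (q i / (V i).lineVar S σ θ h 0
      + (V i).lineVarDeriv S θ h 0 ^ 2 / (2 * (V i).lineVar S σ θ h 0 ^ 2)) ≤ inner ℝ w h) :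
    ENNReal.ofReal (inner ℝ w h) ≤ liminf (fun c : ℝ => liminf (fun n : ℕ =>
      localMinimaxRisk V S σ ψ θ c n (x n) u) atTop) atTop := by
  have hh : 0 < ‖h‖ := norm_pos_iff.2 fun h0 => by simp [h0] at hwh
  set τ := inner ℝ w h with hτ
  have hpos := fun i t => (V i).lineVar_pos θ h hS hσ t
  have main : ∀ ε > 0, ENNReal.ofReal (τ ^ 2 / (τ + ε)) ≤ liminf (fun c : ℝ => liminf (fun n : ℕ =>
      localMinimaxRisk V S σ ψ θ c n (x n) u) atTop) atTop := by
    intro ε hε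
    have hc1 : ∀ᶠ c : ℝ in atTop, 10 * ‖h‖ ^ 2 / c ^ 2 < ε / 2 :=
      (tendsto_const_nhds.div_atTop (tendsto_pow_atTop two_ne_zero)).eventually_lt_const
        (half_pos hε)
    refine le_liminf_of_le (by isBoundedDefault) ?_
    filter_upwards [hc1, eventually_gt_atTop 0] with c hc hc0
    -- continuity in the slack and the parameter
    have hF : Continuous fun z : ℝ × ℝ => ∑ i, ((q i + z.1) / (V i).lineVar S σ θ h z.2
        + (V i).lineVarDeriv S θ h z.2 ^ 2 / (2 * (V i).lineVar S σ θ h z.2 ^ 2)) := by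
      refine continuous_finsetSum _ fun i _ => ?_
      have c1 := (V i).continuous_lineVar (S := S) (σ := σ) θ h
      have c2 := (V i).continuous_lineVarDeriv (S := S) θ h
      refine Continuous.add (Continuous.div (by fun_prop) (by fun_prop) fun z => (hpos i _).ne')
        (Continuous.div (by fun_prop) (by fun_prop) fun z => ?_)
      have := hpos i z.2
      positivity
    have hev := (hF.tendsto (0, 0)).eventually_lt_const (u := τ + ε / 2) (by
      simp only [add_zero]
      linarith)
    obtain ⟨δ, hδ, hball⟩ := Metric.eventually_nhds_iff.1 hev
    have hT : Tendsto (fun n : ℕ => c / (√(n : ℝ) * ‖h‖)) atTop (nhds 0) :=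
      tendsto_const_nhds.div_atTop
        ((Real.tendsto_sqrt_atTop.comp tendsto_natCast_atTop_atTop).atTop_mul_const hh)
    refine le_liminf_of_le (by isBoundedDefault) ?_
    filter_upwards [hT.eventually_lt_const hδ, eventually_gt_atTop 0,
      eventually_all.2 fun i => hx i (δ / 2) (half_pos hδ)] with n hTn hn hxn
    refine le_trans (ENNReal.ofReal_le_ofReal ?_)
      (le_localMinimaxRisk V θ h hS hσ hn (x n) hψ hwh hc0 (K := τ + ε / 2) fun t ht => ?_)
    · rw [← hτ]
      refine div_le_div_of_nonneg_left (sq_nonneg _) (by positivity) ?_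
      linarith
    · have hz := @hball (δ / 2, t) (by
        rw [Prod.dist_eq]
        simp only [Real.dist_eq, sub_zero]
        refine max_lt ?_ (ht.trans_lt hTn)
        rw [abs_of_pos (half_pos hδ)]
        linarith)
      refine le_trans ?_ (mul_le_mul_of_nonneg_left hz.le n.cast_nonneg)
      rw [Finset.mul_sum]
      refine Finset.sum_le_sum fun i _ => ?_
      rw [Finset.sum_add_distrib, ← Finset.sum_div, Finset.sum_const, Finset.card_univ,
        Fintype.card_fin, nsmul_eq_mul, mul_add]
      refine add_le_add ?_ le_rfl
      rw [← mul_div_assoc]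
      exact div_le_div_of_nonneg_right (hxn i) (hpos i t).le
  have hlim : Tendsto (fun ε : ℝ => ENNReal.ofReal (τ ^ 2 / (τ + ε))) (nhdsWithin 0 (Set.Ioi 0))
      (nhds (ENNReal.ofReal τ)) := by
    refine (ENNReal.continuous_ofReal.tendsto _).comp ?_
    have h1 : ContinuousAt (fun ε : ℝ => τ ^ 2 / (τ + ε)) 0 :=
      ContinuousAt.div (by fun_prop) (by fun_prop) (by simpa using hwh.ne')
    have h2 := h1.tendsto.mono_left (nhdsWithin_le_nhds (s := Set.Ioi 0))
    convert h2 using 2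
    rw [add_zero, sq, mul_div_assoc, div_self hwh.ne', mul_one]
  exact le_of_tendsto hlim (eventually_mem_nhdsWithin.mono fun ε hε => main ε hε)

variable {Ω : Type*} [MeasurableSpace Ω] {P : Measure Ω} [IsProbabilityMeasure P]

/-- The almost sure lower bound for the risk of estimating a linear functional `⟨w, ·⟩`. -/
lemma ae_le_liminf_localMinimaxRisk (hS : S.PosDef) (hσ : 0 < σ)
    {X : (n : ℕ) → (i : Fin m) → Fin n → Ω → EuclideanSpace ℝ (Fin (V i).numObs)}
    (hlaw : ∀ n i k, HasLaw (X n i k) (multivariateGaussian 0 ((V i).blockPlus S)) P)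
    (hindep : ∀ n i, iIndepFun (X n i) P) {s : ℕ}
    {ψ : EuclideanSpace ℝ (Fin d) → EuclideanSpace ℝ (Fin s)}
    {u : EuclideanSpace ℝ (Fin s)} {w : EuclideanSpace ℝ (Fin d)}
    (hψ : ∀ θ', inner ℝ u (ψ θ') = inner ℝ w θ') :
    ∀ᵐ ω ∂P, ENNReal.ofReal (w.ofLp ⬝ᵥ (strongBound V S σ θ *ᵥ w.ofLp)) ≤
      liminf (fun c : ℝ => liminf (fun n : ℕ =>
        localMinimaxRisk V S σ ψ θ c n (fun i k => X n i k ω) u) atTop) atTop := by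
  set C := strongBound V S σ θ with hC
  set h : EuclideanSpace ℝ (Fin d) := WithLp.toLp 2 (C *ᵥ w.ofLp) with hh
  have hwh : inner ℝ w h = w.ofLp ⬝ᵥ (C *ᵥ w.ofLp) := by
    rw [EuclideanSpace.inner_eq_star_dotProduct, star_trivial, hh, dotProduct_comm]
  rw [← hwh]
  rcases le_or_gt (inner ℝ w h) 0 with h0 | h0
  · rw [ENNReal.ofReal_of_nonpos h0]
    simp
  set q : Fin m → ℝ := fun i =>
    ((V i).T S *ᵥ h.ofLp) ⬝ᵥ (V i).blockPlus S *ᵥ ((V i).T S *ᵥ h.ofLp) with hq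
  have hq0 : ∀ i, 0 ≤ q i := fun i => by
    have h := ((V i).blockPlus_posDef hS).posSemidef.dotProduct_mulVec_nonneg ((V i).T S *ᵥ h.ofLp)
    rwa [star_trivial] at h
  set M := ∑ i, (2 / ((V i).misVar S θ + σ ^ 2)) • S with hM
  have hunit : IsUnit M.det := by
    by_contra hcon
    have hC0 : C = 0 := by
      rw [hC, strongBound, ← hM]
      exact Matrix.nonsing_inv_apply_not_isUnit M hcon
    rw [hwh, hC0] at h0
    simp at h0
  have hMh : h.ofLp ⬝ᵥ M *ᵥ h.ofLp = inner ℝ w h := by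
    have : M *ᵥ h.ofLp = w.ofLp := by
      rw [hh, hC, strongBound, ← hM]
      simp [Matrix.mulVec_mulVec, Matrix.mul_nonsing_inv _ hunit]
    rw [this, hwh, dotProduct_comm]
  have hsum : ∑ i, (q i / (V i).lineVar S σ θ h 0
      + (V i).lineVarDeriv S θ h 0 ^ 2 / (2 * (V i).lineVar S σ θ h 0 ^ 2)) ≤ inner ℝ w h := by
    rw [← hMh, hM, Matrix.sum_mulVec, dotProduct_sum]
    refine Finset.sum_le_sum fun i _ => ?_
    rw [Matrix.smul_mulVec, dotProduct_smul, smul_eq_mul]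
    exact (V i).info_le θ h hS hσ
  have hae : ∀ i, ∀ᵐ ω ∂P, ∀ δ > 0, ∀ᶠ n : ℕ in atTop,
      ∑ k, inner ℝ (X n i k ω) (WithLp.toLp 2 ((V i).T S *ᵥ h.ofLp)) ^ 2 ≤ n * (q i + δ) := by
    intro i
    refine ae_eventually_sum_sq_le (hq0 i)
      (G := fun n k ω => inner ℝ (X n i k ω) (WithLp.toLp 2 ((V i).T S *ᵥ h.ofLp)))
      (fun n k => ⟨?_, ?_⟩) fun n => ?_
    · have := (hlaw n i k).aemeasurable
      fun_prop
    · have e := multivariateGaussian_map_inner 0 (WithLp.toLp 2 ((V i).T S *ᵥ h.ofLp))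
        ((V i).blockPlus_posDef hS).posSemidef
      rw [inner_zero_left, ← (hlaw n i k).map_eq, AEMeasurable.map_map_of_aemeasurable
        (by fun_prop) (hlaw n i k).aemeasurable] at e
      exact e
    · exact (hindep n i).comp (fun _ z => inner ℝ z (WithLp.toLp 2 ((V i).T S *ᵥ h.ofLp)))
        fun _ => by fun_prop
  filter_upwards [ae_all_iff.2 hae] with ω hω
  exact le_liminf_localMinimaxRisk V θ h hS hσ (fun n i k => X n i k ω) hψ h0 hω hsum

end Asymptotic

end

theorem mainTheorem4 {d m : ℕ} (V : Fin m → AgentView d)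
    (S : Matrix (Fin d) (Fin d) ℝ) (hS : S.PosDef) (σ : ℝ) (hσ : 0 < σ)
    (θ : EuclideanSpace ℝ (Fin d))
    {Ω : Type*} [MeasurableSpace Ω] (P : Measure Ω) [IsProbabilityMeasure P]
    (X : (n : ℕ) → (i : Fin m) → Fin n → Ω → EuclideanSpace ℝ (Fin (V i).numObs))
    (hlaw : ∀ n i k, HasLaw (X n i k) (multivariateGaussian 0 ((V i).blockPlus S)) P)
    (hindep : ∀ n i, iIndepFun (X n i) P) :
    (∀ u : EuclideanSpace ℝ (Fin d), ∀ᵐ ω ∂P,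
      ENNReal.ofReal (u.ofLp ⬝ᵥ (strongBound V S σ θ *ᵥ u.ofLp)) ≤
        liminf (fun c : ℝ => liminf (fun n : ℕ =>
          localMinimaxRisk V S σ id θ c n (fun i k => X n i k ω) u) atTop) atTop) ∧
    (∀ (i : Fin m) (u : EuclideanSpace ℝ (Fin (V i).numObs)), ∀ᵐ ω ∂P,
      ENNReal.ofReal (u.ofLp ⬝ᵥ
          (((V i).T S * strongBound V S σ θ * ((V i).T S)ᵀ) *ᵥ u.ofLp)) ≤
        liminf (fun c : ℝ => liminf (fun n : ℕ =>
          localMinimaxRisk V S σ (fun θ' => WithLp.toLp 2 ((V i).T S *ᵥ θ'.ofLp)) θ c n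
            (fun j k => X n j k ω) u) atTop) atTop) := by
  refine ⟨fun u => ae_le_liminf_localMinimaxRisk V θ hS hσ hlaw hindep fun _ => rfl, fun i u => ?_⟩
  have h := ae_le_liminf_localMinimaxRisk V θ hS hσ hlaw hindep
    (ψ := fun θ' => WithLp.toLp 2 ((V i).T S *ᵥ θ'.ofLp)) (u := u)
    (w := WithLp.toLp 2 (((V i).T S)ᵀ *ᵥ u.ofLp)) fun θ' => by
      simp only [EuclideanSpace.inner_eq_star_dotProduct, star_trivial]
      rw [Matrix.mulVec_transpose, dotProduct_comm, dotProduct_comm θ'.ofLp,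
        Matrix.dotProduct_mulVec]
  convert! h using 4
  rw [← Matrix.mulVec_mulVec, ← Matrix.mulVec_mulVec, Matrix.dotProduct_mulVec,
    ← Matrix.mulVec_transpose]
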